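/- There is an absolute constant $C>0$ such that the following holds for all $n\ge 1$, $H\ge 0$, $\varepsilon>0$, $\delta\in(0,1)$. Setting. In a single-item auction with $n$ bidders, bidder $i$ has a value in $T_i\subseteq[0,H]$ and bids $b_i\in[0,H]$. The highest bid wins with uniform tie-breaking: $x_i(b)=\mathbb 1[b_i=\max_j b_j]/|\operatorname{argmax}_j b_j|$. Bidder $i$ pays $p_i(b)=x_i(b)f_i(b_i)+g_i(b_i)$, where $0\le f_i,g_i\le H$, and for all $b_{-i}$ and $b_i<b_i'$, if $x_i(b_i,b_{-i})>0$ then $p_i(b_i',b_{-i})>p_i(b_i,b_{-i})$. Her ex post utility at value $v_i$ is $U_i(v_i,b)=v_ix_i(b)-p_i(b)$. A joint strategy $s=(s_1,\dots,s_n)$, $s_i:T_i\to[0,H]$, is monotone if every $s_i$ is weakly increasing. For a product distribution $D=\prod_i D_i$, with $D_i$ a probability distribution on $T_i$, the interim utility is $u_i(v_i,b_i,s_{-i})=\mathbb E_{v_{-i}\sim D_{-i}}[U_i(v_i,b_i,s_{-i}(v_{-i}))]$. Claim. Let $$M= C\,\frac{H^2}{\varepsilon^2}\Big[n\log n\cdot\max\{1,\log(H/\varepsilon)\}+\log(n/\delta)\Big].$$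 For every integer $m\ge M$ (with $m\ge 0$), all such $T_i$, all such payment rules and every such $D$, with probability at least $1-\delta$ over $m$ independent samples $v^{(1)},\dots,v^{(m)}$ from $D$, simultaneously for all monotone joint strategies $s$, all bidders $i$ and all values $v_i\in T_i$, $$\Big|\frac1m\sum_{k=1}^m U_i\big(v_i,s_i(v_i),s_{-i}(v_{-i}^{(k)})\big)-u_i\big(v_i,s_i(v_i),s_{-i}\big)\Big|<\varepsilon .$$ (When $m=0$, which $m\ge M$ allows only if $H=0$, the average is read as $0$.) -/

import Mathlib

open MeasureTheory

noncomputable section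

namespace SampleAuction

/-- Bids are real numbers in `[0, H]`. -/
abbrev Bid (H : ℝ) : Type := Set.Icc (0 : ℝ) H

/-- The set of highest bidders, `argmax_j b_j`. -/
def winners {n : ℕ} {H : ℝ} (b : Fin n → Bid H) : Finset (Fin n) :=
  Finset.univ.filter fun k => ∀ j, b j ≤ b k

/-- The probability that bidder `i` gets the item: the highest bid wins, ties are broken uniformly
at random. -/
def alloc {n : ℕ} {H : ℝ} (b : Fin n → Bid H) (i : Fin n) : ℝ :=
  if i ∈ winners b then 1 / ((winners b).card : ℝ) else 0

/-- The payment `x_i(b) f_i(b_i) + g_i(b_i)` of bidder `i` at the bid profile `b`. -/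
def pay {n : ℕ} {H : ℝ} (f g : Fin n → Bid H → ℝ) (b : Fin n → Bid H) (i : Fin n) : ℝ :=
  alloc b i * f i (b i) + g i (b i)

/-- The payment rules considered: `0 ≤ f_i, g_i ≤ H`, and, the bids of the others being fixed, a
bidder who wins with positive probability pays strictly more at every higher bid. -/
structure PaymentRule (n : ℕ) (H : ℝ) where
  f : Fin n → Bid H → ℝ
  g : Fin n → Bid H → ℝ
  f_mem : ∀ i b, f i b ∈ Set.Icc 0 H
  g_mem : ∀ i b, g i b ∈ Set.Icc 0 H
  strict_increasing : ∀ (i : Fin n) (b : Fin n → Bid H) (b' : Bid H), b i < b' →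
    0 < alloc b i → pay f g b i < pay f g (Function.update b i b') i

/-- Bidder `i`'s ex post utility `v x_i(b) - p_i(b)`. -/
def exPostUtility {n : ℕ} {H : ℝ} (p : PaymentRule n H) (i : Fin n) (v : ℝ)
    (b : Fin n → Bid H) : ℝ :=
  v * alloc b i - pay p.f p.g b i

/-- The bid profile `(b_i, b_{-i})`. -/
def joinBids {n : ℕ} {H : ℝ} (i : Fin n) (bi : Bid H) (bo : {j : Fin n // j ≠ i} → Bid H) :
    Fin n → Bid H :=
  fun j => if h : j = i then bi else bo ⟨j, h⟩

/-- Joint bidding strategies: bidder `i` maps values in `T i` to bids in `[0, H]`. -/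
abbrev Profile {n : ℕ} (H : ℝ) (T : Fin n → Set ℝ) : Type :=
  (i : Fin n) → T i → Bid H

/-- All monotone (weakly increasing) joint bidding strategies. -/
def monotoneProfiles {n : ℕ} (H : ℝ) (T : Fin n → Set ℝ) : Set (Profile H T) :=
  {s | ∀ i, Monotone (s i)}

/-- Bidder `i`'s interim utility at value `v` and bid `bi` when the others use the strategies `s`
(the `i`-th one is not used): the expectation of the ex post utility over the values of the others,
which are independent with laws `D j`. -/
def interimUtility {n : ℕ} {H : ℝ} (p : PaymentRule n H) {T : Fin n → Set ℝ}
    (D : (i : Fin n) → Measure (T i)) (i : Fin n) (v : T i) (bi : Bid H)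
    (s : (j : {j : Fin n // j ≠ i}) → T j → Bid H) : ℝ :=
  ∫ w : (j : {j : Fin n // j ≠ i}) → T j,
    exPostUtility p i v (joinBids i bi fun j => s j (w j))
    ∂(Measure.pi fun j : {j : Fin n // j ≠ i} => D j)

/-- An algorithm that takes `m` sampled value profiles, a bidder, a value of that bidder and a joint
strategy, and outputs an estimate of the interim utility. -/
abbrev Estimator {n : ℕ} (m : ℕ) (H : ℝ) (T : Fin n → Set ℝ) : Type :=
  (Fin m → (i : Fin n) → T i) → (i : Fin n) → T i → Profile H T → ℝ

/-- The empirical distribution estimator: the average of the ex post utility over the samples. -/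
def emp {n m : ℕ} {H : ℝ} {T : Fin n → Set ℝ} (p : PaymentRule n H) : Estimator m H T :=
  fun S i v s => (1 / (m : ℝ)) * ∑ k : Fin m,
    exPostUtility p i v (joinBids i (s i v) fun j => s j (S k j))

/-- `A` `(ε, δ)`-estimates, with `m` samples, the utilities over `B`: for every product value
distribution, with probability at least `1 - δ` over `m` independent samples, the estimates of all
interim utilities, for all strategies in `B` at once, have error less than `ε`. The failure event
is measured by the outer measure, so that nothing depends on its measurability. -/
def EstimatesUtilities {n m : ℕ} {H : ℝ} {T : Fin n → Set ℝ} (p : PaymentRule n H)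
    (A : Estimator m H T) (B : Set (Profile H T)) (ε δ : ℝ) : Prop :=
  ∀ (D : (i : Fin n) → Measure (T i)) [∀ i, IsProbabilityMeasure (D i)],
    (Measure.pi fun _ : Fin m => Measure.pi D)
      {S | ¬ ∀ s ∈ B, ∀ (i : Fin n) (v : T i),
        |A S i v s - interimUtility p D i v (s i v) fun j => s j| < ε} ≤ ENNReal.ofReal δ

end SampleAuction

end

/-! Fix bidder `i` and her bid `b`. Her utility is affine in her share of the item, and that share
depends on a rival `j` only through two sets of values: `U j`, where `j` bids at most `b`, and `L
j`, where `j` bids less than `b`. Monotone strategies make both lower sets of reals. So it suffices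
to estimate all functions `winShare U L` uniformly to within `ε / H`, since the slope `v - f` is at
most `H` in absolute value (`estimatesUtilities_of_winShare`).

Lower sets of the line are simple: under any law, `N + 1` brackets of mass at most `1 / N` capture
them all (`exists_lowerSet_brackets`). The share is monotone in each `U j` and `L j`, so these
combine into at most `2 (N + 1) ^ (2n)` measurable bracketing functions per bidder, of `L¹` gap at
most `2n / N` (`exists_winShare_brackets`). Product structure is used only here, coordinate by
coordinate. Hoeffding and a union bound control the brackets, hence everything between them
(`measure_winShare_error_le`). Taking `N` of order `n H / ε` gives the sample size
(`exists_bracket_count`). -/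

open ProbabilityTheory

namespace SampleAuction

/-! ### Concentration of empirical means -/

/-- **Hoeffding's inequality** for the empirical mean of a `[0, 1]`-valued function, two-sided. -/
theorem measure_abs_empirical_mean_sub_integral_ge_le {Ω : Type*} [MeasurableSpace Ω]
    (P : Measure Ω) [IsProbabilityMeasure P] {h : Ω → ℝ} (hm : Measurable h)
    (h01 : ∀ w, h w ∈ Set.Icc (0 : ℝ) 1) {m : ℕ} (hpos : 0 < m) {t : ℝ} (ht : 0 ≤ t) :
    (Measure.pi fun _ : Fin m => P)
        {S | t ≤ |(1 / (m : ℝ)) * ∑ k, h (S k) - ∫ w, h w ∂P|}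
      ≤ ENNReal.ofReal (2 * Real.exp (-(2 * m * t ^ 2))) := by
  set μ := Measure.pi fun _ : Fin m => P
  have hm' : (0 : ℝ) < m := by exact_mod_cast hpos
  set X : Ω → ℝ := fun w => h w - ∫ w, h w ∂P with hX
  have hXm : Measurable X := hm.sub_const _
  have hsub : HasSubgaussianMGF X ((‖(1 : ℝ) - 0‖₊ / 2) ^ 2) P :=
    hasSubgaussianMGF_of_mem_Icc hm.aemeasurable (.of_forall h01)
  have hcoord (k : Fin m) : HasSubgaussianMGF (fun S : Fin m → Ω => X (S k))
      ((‖(1 : ℝ) - 0‖₊ / 2) ^ 2) μ := by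
    have hp := measurePreserving_eval (fun _ : Fin m => P) k
    refine HasSubgaussianMGF.of_map (Y := fun S : Fin m → Ω => S k) (X := X)
      hp.measurable.aemeasurable ?_
    have := hp.map_eq
    unfold Function.eval at this
    rwa [this]
  have hind : iIndepFun (fun (k : Fin m) (S : Fin m → Ω) => X (S k)) μ :=
    iIndepFun_pi (μ := fun _ : Fin m => P) (X := fun _ => X) fun _ => hXm.aemeasurable
  have hind' : iIndepFun (fun (k : Fin m) (S : Fin m → Ω) => -X (S k)) μ :=
    iIndepFun_pi (μ := fun _ : Fin m => P) (X := fun _ w => -X w) fun _ => hXm.neg.aemeasurable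
  -- Each summand ranges over an interval of length one, so its sub-Gaussian parameter is `1 / 4`.
  have hexp : -(m * t) ^ 2 / (2 * ∑ _k : Fin m,
      (((‖(1 : ℝ) - 0‖₊ / 2) ^ 2 : NNReal) : ℝ)) = -(2 * m * t ^ 2) := by
    simp
    field_simp
  have h1 := HasSubgaussianMGF.measure_sum_ge_le_of_iIndepFun hind (s := Finset.univ)
    (fun k _ => hcoord k) (ε := m * t) (by positivity)
  have h2 := HasSubgaussianMGF.measure_sum_ge_le_of_iIndepFun hind' (s := Finset.univ)
    (fun k _ => (hcoord k).neg) (ε := m * t) (by positivity)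
  push_cast at h1 h2 hexp
  rw [hexp] at h1 h2
  have hsum (S : Fin m → Ω) :
      (m : ℝ) * ((1 / (m : ℝ)) * ∑ k, h (S k) - ∫ w, h w ∂P) = ∑ k, X (S k) := by
    simp only [hX, Finset.sum_sub_distrib, Finset.sum_const, Finset.card_univ, Fintype.card_fin,
      nsmul_eq_mul]
    field_simp
  calc μ {S | t ≤ |(1 / (m : ℝ)) * ∑ k, h (S k) - ∫ w, h w ∂P|}
      ≤ μ ({S | m * t ≤ ∑ k, X (S k)} ∪ {S | m * t ≤ ∑ k, -X (S k)}) := by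
        refine measure_mono fun S hS => ?_
        simp only [Set.mem_union, Set.mem_ofPred_eq, Finset.sum_neg_distrib, ← hsum] at hS ⊢
        rw [← mul_neg]
        rcases le_abs.1 hS with h | h
        · exact .inl (by gcongr)
        · exact .inr (by gcongr)
    _ ≤ μ {S | m * t ≤ ∑ k, X (S k)} + μ {S | m * t ≤ ∑ k, -X (S k)} := measure_union_le _ _
    _ ≤ ENNReal.ofReal (Real.exp (-(2 * m * t ^ 2))) +
        ENNReal.ofReal (Real.exp (-(2 * m * t ^ 2))) := by
        refine add_le_add ?_ ?_
        · rw [← ofReal_measureReal]; exact ENNReal.ofReal_le_ofReal h1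
        · rw [← ofReal_measureReal]; exact ENNReal.ofReal_le_ofReal h2
    _ = _ := by rw [← ENNReal.ofReal_add (by positivity) (by positivity), ← two_mul]

theorem measure_exists_abs_empirical_mean_sub_integral_ge_le {Ω κ : Type*} [MeasurableSpace Ω]
    [Fintype κ] (P : Measure Ω) [IsProbabilityMeasure P] {h : κ → Ω → ℝ}
    (hm : ∀ a, Measurable (h a)) (h01 : ∀ a w, h a w ∈ Set.Icc (0 : ℝ) 1) {m : ℕ} (hpos : 0 < m)
    {t : ℝ} (ht : 0 ≤ t) :
    (Measure.pi fun _ : Fin m => P)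
        {S | ∃ a, t ≤ |(1 / (m : ℝ)) * ∑ k, h a (S k) - ∫ w, h a w ∂P|}
      ≤ Fintype.card κ * ENNReal.ofReal (2 * Real.exp (-(2 * m * t ^ 2))) := by
  rw [Set.ofPred_exists]
  refine (measure_iUnion_fintype_le _ _).trans ?_
  refine (Finset.sum_le_sum fun a _ =>
    measure_abs_empirical_mean_sub_integral_ge_le P (hm a) (h01 a) hpos ht).trans ?_
  simp

/-! ### Bracketing lower sets of reals -/

theorem measurableSet_of_isLowerSet_subtype {T : Set ℝ} {U : Set T} (hU : IsLowerSet U) :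
    MeasurableSet U := by
  have : U = Subtype.val ⁻¹' (lowerClosure (Subtype.val '' U) : Set ℝ) := by
    ext x
    simp only [Set.mem_preimage, SetLike.mem_coe, mem_lowerClosure]
    constructor
    · exact fun hx => ⟨x, ⟨x, hx, rfl⟩, le_rfl⟩
    · rintro ⟨_, ⟨y, hy, rfl⟩, hxy⟩
      exact hU hxy hy
  rw [this]
  exact (lowerClosure _).lower.ordConnected.measurableSet.preimage measurable_subtype_coe

theorem isLowerSet_setOf_measure_Iic_lt (μ : Measure ℝ) (c : ENNReal) :
    IsLowerSet {x | μ (Set.Iic x) < c} :=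
  fun _ _ hxy hx => (measure_mono (Set.Iic_subset_Iic.2 hxy)).trans_lt hx

theorem isLowerSet_setOf_measure_Iio_lt (μ : Measure ℝ) (c : ENNReal) :
    IsLowerSet {x | μ (Set.Iio x) < c} :=
  fun _ _ hxy hx => (measure_mono (Set.Iio_subset_Iio hxy)).trans_lt hx

/-- Otherwise inner regularity gives a compact subset of mass above `c`; it lies in `Iic x` for its
greatest point `x`, contradicting membership of `x`. -/
theorem measure_setOf_measure_Iic_lt_le (μ : Measure ℝ) [IsFiniteMeasure μ] (c : ENNReal) :
    μ {x | μ (Set.Iic x) < c} ≤ c := by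
  by_contra! h
  obtain ⟨K, hK, hKc, hlt⟩ := (isLowerSet_setOf_measure_Iic_lt μ c).ordConnected.measurableSet
    |>.exists_lt_isCompact h
  have hne : K.Nonempty := nonempty_of_measure_ne_zero (pos_of_gt hlt).ne'
  obtain ⟨x, hx⟩ := hKc.exists_isGreatest hne
  exact absurd (hlt.trans_le (measure_mono hx.2)) (hK hx.1).le.not_gt

/-- The mirror argument: a compact subset of the complement with mass above `1 - c` lies to the
right of its least point. -/
theorem le_measure_setOf_measure_Iio_lt (μ : Measure ℝ) [IsProbabilityMeasure μ] {c : ENNReal}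
    (hc : c ≤ 1) : c ≤ μ {x | μ (Set.Iio x) < c} := by
  have hms := (isLowerSet_setOf_measure_Iio_lt μ c).ordConnected.measurableSet
  by_contra! h
  have h' : 1 - c < μ {x | μ (Set.Iio x) < c}ᶜ := by
    rw [prob_compl_eq_one_sub hms]
    exact ((ENNReal.cancel_of_ne ENNReal.one_ne_top).tsub_lt_tsub_iff_left_of_le
      (ENNReal.cancel_of_ne (hc.trans_lt ENNReal.one_lt_top).ne) hc).2 h
  obtain ⟨K, hK, hKc, hlt⟩ := hms.compl.exists_lt_isCompact h'
  have hne : K.Nonempty := nonempty_of_measure_ne_zero (pos_of_gt hlt).ne'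
  obtain ⟨x, hx⟩ := hKc.exists_isLeast hne
  have h1 : 1 - c < μ (Set.Iio x)ᶜ := by
    rw [Set.compl_Iio]
    exact hlt.trans_le (measure_mono hx.2)
  rw [prob_compl_eq_one_sub measurableSet_Iio] at h1
  have h2 := hK hx.1
  simp only [Set.mem_compl_iff, Set.mem_ofPred_eq, not_lt] at h2
  exact absurd h1 (tsub_le_tsub_left h2 1).not_gt

/-- The lower sets of a set of reals are covered by `N + 1` brackets of probability at most
`1 / N`. -/
theorem exists_lowerSet_brackets {T : Set ℝ} (D : Measure T) [IsProbabilityMeasure D] {N : ℕ}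
    (hN : 0 < N) :
    ∃ A B : Fin (N + 1) → Set T, (∀ k, MeasurableSet (A k)) ∧ (∀ k, MeasurableSet (B k)) ∧
      ∀ U : Set T, IsLowerSet U → ∃ k, A k ⊆ U ∧ U ⊆ B k ∧ D.real (B k \ A k) ≤ 1 / N := by
  have hN' : (0 : ℝ) < N := by exact_mod_cast hN
  set μ := D.map Subtype.val
  have hμ : IsProbabilityMeasure μ := Measure.isProbabilityMeasure_map (by fun_prop)
  -- With atoms, `Iio` gives `a k` mass at least `k / N` and `Iic` gives `b k` mass at most `(k + 1)
  -- / N`. The inclusion `a k ⊆ b k` may fail for some `k`, but holds whenever some `U` is assigned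
  -- to `k`.
  set a : ℕ → Set ℝ := fun k => {x | μ (Set.Iio x) < ENNReal.ofReal (k / N)}
  set b : ℕ → Set ℝ := fun k => {x | μ (Set.Iic x) < ENNReal.ofReal ((k + 1) / N)}
  have ha (k) : MeasurableSet (a k) :=
    (isLowerSet_setOf_measure_Iio_lt _ _).ordConnected.measurableSet
  have hb (k) : MeasurableSet (b k) :=
    (isLowerSet_setOf_measure_Iic_lt _ _).ordConnected.measurableSet
  refine ⟨fun k => Subtype.val ⁻¹' a k, fun k => Subtype.val ⁻¹' b k,
    fun k => (ha k).preimage measurable_subtype_coe,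
    fun k => (hb k).preimage measurable_subtype_coe, fun U hU => ?_⟩
  have hU1 : D.real U ≤ 1 := measureReal_le_one
  have hU0 : 0 ≤ D.real U := measureReal_nonneg
  set k := ⌊N * D.real U⌋₊
  have hk1 : (k : ℝ) ≤ N * D.real U := Nat.floor_le (by positivity)
  have hk2 : N * D.real U < k + 1 := Nat.lt_floor_add_one _
  have hkN : k < N + 1 := by
    have : (k : ℝ) ≤ N := hk1.trans (by nlinarith)
    exact Nat.lt_succ_of_le (by exact_mod_cast this)
  have hsubA : Subtype.val ⁻¹' a k ⊆ U := by
    intro x hx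
    by_contra hxU
    have h1 : D U ≤ μ (Set.Iio (x : ℝ)) := by
      rw [Measure.map_apply measurable_subtype_coe measurableSet_Iio]
      refine measure_mono fun y hy => ?_
      by_contra hyx
      exact hxU (hU (not_lt.1 hyx) hy)
    have h2 : D U < ENNReal.ofReal (k / N) := h1.trans_lt hx
    rw [← ofReal_measureReal, ENNReal.ofReal_lt_ofReal_iff_of_nonneg hU0, lt_div_iff₀ hN'] at h2
    linarith
  have hsubB : U ⊆ Subtype.val ⁻¹' b k := by
    intro x hx
    have h1 : μ (Set.Iic (x : ℝ)) ≤ D U := by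
      rw [Measure.map_apply measurable_subtype_coe measurableSet_Iic]
      exact measure_mono fun y hy => hU hy hx
    refine h1.trans_lt ?_
    rw [← ofReal_measureReal, ENNReal.ofReal_lt_ofReal_iff_of_nonneg hU0, lt_div_iff₀ hN']
    linarith
  refine ⟨⟨k, hkN⟩, hsubA, hsubB, ?_⟩
  have h1 : D.real (Subtype.val ⁻¹' b k) ≤ (k + 1) / N := by
    refine ENNReal.toReal_le_of_le_ofReal (by positivity) ?_
    rw [← Measure.map_apply measurable_subtype_coe (hb k)]
    exact measure_setOf_measure_Iic_lt_le μ _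
  have h2 : (k : ℝ) / N ≤ D.real (Subtype.val ⁻¹' a k) := by
    refine (ENNReal.ofReal_le_iff_le_toReal (measure_ne_top _ _)).1 ?_
    rw [← Measure.map_apply measurable_subtype_coe (ha k)]
    refine le_measure_setOf_measure_Iio_lt μ (ENNReal.ofReal_le_one.2 ?_)
    rw [div_le_one hN']
    exact_mod_cast Nat.lt_succ_iff.1 hkN
  rw [measureReal_sdiff (hsubA.trans hsubB) ((ha k).preimage measurable_subtype_coe)]
  have : ((k : ℝ) + 1) / N = k / N + 1 / N := by ring
  linarith


/-! ### The share of the item as a function of sets -/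

section WinShare

open scoped Classical in
/-- The share of the item of a bidder whose rival `j` bids at most as much as she does when
`w j ∈ U j`, and strictly less when `w j ∈ L j`. -/
noncomputable def winShare {ι : Type*} [Fintype ι] {X : ι → Type*} (U L : ∀ j, Set (X j))
    (w : ∀ j, X j) : ℝ :=
  if ∀ j, w j ∈ U j then 1 / (1 + (Finset.univ.filter fun j => w j ∉ L j).card : ℝ) else 0

variable {ι : Type*} [Fintype ι] {X : ι → Type*} {U L U' L' : ∀ j, Set (X j)}

theorem winShare_mem_Icc (U L : ∀ j, Set (X j)) (w : ∀ j, X j) :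
    winShare U L w ∈ Set.Icc (0 : ℝ) 1 := by
  classical
  unfold winShare
  split_ifs
  · refine ⟨by positivity, ?_⟩
    rw [div_le_one (by positivity)]
    linarith [Nat.cast_nonneg (α := ℝ) (Finset.univ.filter fun j => w j ∉ L j).card]
  · simp

/-- Enlarging `U` makes winning easier; enlarging `L` removes ties. -/
theorem winShare_mono (hU : ∀ j, U j ⊆ U' j) (hL : ∀ j, L j ⊆ L' j) (w : ∀ j, X j) :
    winShare U L w ≤ winShare U' L' w := by
  classical
  by_cases h : ∀ j, w j ∈ U j
  · rw [winShare, winShare, if_pos h, if_pos fun j => hU j (h j)]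
    gcongr with j
    exact hL j
  · rw [winShare, if_neg h]
    exact (winShare_mem_Icc U' L' w).1

/-- The two shares differ only if some `w j` falls in a gap, and then by at most one. -/
theorem winShare_le_add_sum (hU : ∀ j, U j ⊆ U' j) (hL : ∀ j, L j ⊆ L' j) (w : ∀ j, X j) :
    winShare U' L' w ≤ winShare U L w +
      ∑ j, ((U' j \ U j).indicator 1 (w j) + (L' j \ L j).indicator 1 (w j)) := by
  classical
  have hnn (V : ∀ j, Set (X j)) (j) : 0 ≤ (V j).indicator (1 : X j → ℝ) (w j) :=
    Set.indicator_nonneg (fun _ _ => zero_le_one) _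
  have hsum : ∀ j, 0 ≤ (U' j \ U j).indicator (1 : X j → ℝ) (w j) +
      (L' j \ L j).indicator 1 (w j) :=
    fun j => add_nonneg (hnn (fun j => U' j \ U j) j) (hnn (fun j => L' j \ L j) j)
  by_cases h : ∃ j, w j ∈ U' j \ U j ∨ w j ∈ L' j \ L j
  · obtain ⟨j, hj⟩ := h
    have h1 : 1 ≤ (U' j \ U j).indicator (1 : X j → ℝ) (w j) +
        (L' j \ L j).indicator 1 (w j) := by
      rcases hj with hj | hj
      · rw [Set.indicator_of_mem hj]
        simpa using hnn (fun j => L' j \ L j) j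
      · rw [Set.indicator_of_mem hj]
        simpa using hnn (fun j => U' j \ U j) j
    have h2 := Finset.single_le_sum (fun j _ => hsum j) (Finset.mem_univ j)
    linarith [(winShare_mem_Icc U' L' w).2, (winShare_mem_Icc U L w).1]
  · push Not at h
    have hUw (j) : w j ∈ U' j ↔ w j ∈ U j :=
      ⟨fun hj => by by_contra hn; exact (h j).1 ⟨hj, hn⟩, fun hj => hU j hj⟩
    have hLw (j) : w j ∈ L' j ↔ w j ∈ L j :=
      ⟨fun hj => by by_contra hn; exact (h j).2 ⟨hj, hn⟩, fun hj => hL j hj⟩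
    have : winShare U' L' w = winShare U L w := by
      refine if_congr (forall_congr' hUw) ?_ rfl
      rw [Finset.filter_congr fun j _ => not_congr (hLw j)]
    rw [this]
    exact le_add_of_nonneg_right (Finset.sum_nonneg fun j _ => hsum j)

variable [∀ j, MeasurableSpace (X j)]

theorem measurable_winShare (hU : ∀ j, MeasurableSet (U j)) (hL : ∀ j, MeasurableSet (L j)) :
    Measurable (winShare U L) := by
  classical
  refine Measurable.ite ?_ ?_ measurable_const
  · rw [Set.ofPred_forall]
    exact MeasurableSet.iInter fun j => (hU j).preimage (measurable_pi_apply j)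
  · simp only [Finset.card_filter, Nat.cast_sum]
    refine measurable_const.div (measurable_const.add (Finset.measurable_fun_sum _ fun j _ => ?_))
    refine measurable_from_top.comp (Measurable.ite ?_ measurable_const measurable_const)
    exact ((hL j).preimage (measurable_pi_apply j)).compl

theorem integrable_winShare (hU : ∀ j, MeasurableSet (U j)) (hL : ∀ j, MeasurableSet (L j))
    (P : Measure (∀ j, X j)) [IsFiniteMeasure P] : Integrable (winShare U L) P :=
  Integrable.of_mem_Icc 0 1 (measurable_winShare hU hL).aemeasurable
    (.of_forall (winShare_mem_Icc U L))

theorem integral_winShare_le_add_sum (D : ∀ j, Measure (X j)) [∀ j, IsProbabilityMeasure (D j)]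
    (hU : ∀ j, U j ⊆ U' j) (hL : ∀ j, L j ⊆ L' j)
    (mU : ∀ j, MeasurableSet (U j)) (mL : ∀ j, MeasurableSet (L j))
    (mU' : ∀ j, MeasurableSet (U' j)) (mL' : ∀ j, MeasurableSet (L' j)) :
    ∫ w, winShare U' L' w ∂Measure.pi D ≤ ∫ w, winShare U L w ∂Measure.pi D +
      ∑ j, ((D j).real (U' j \ U j) + (D j).real (L' j \ L j)) := by
  have hind {j : ι} {V : Set (X j)} (hV : MeasurableSet V) :
      Integrable (fun w : ∀ j, X j => V.indicator (1 : X j → ℝ) (w j)) (Measure.pi D) ∧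
      ∫ w, V.indicator (1 : X j → ℝ) (w j) ∂Measure.pi D = (D j).real V := by
    have hp := measurePreserving_eval D j
    have hi : Integrable (V.indicator (1 : X j → ℝ)) (D j) :=
      (integrable_const (1 : ℝ)).indicator hV
    refine ⟨hp.integrable_comp_of_integrable hi, ?_⟩
    rw [← integral_indicator_one hV, ← hp.map_eq]
    refine (integral_map hp.measurable.aemeasurable ?_).symm
    rw [hp.map_eq]
    exact hi.aestronglyMeasurable
  have hd (j) := hind ((mU' j).diff (mU j))
  have hd' (j) := hind ((mL' j).diff (mL j))
  have hs : Integrable (fun w : ∀ j, X j => ∑ j, ((U' j \ U j).indicator (1 : X j → ℝ) (w j) +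
      (L' j \ L j).indicator 1 (w j))) (Measure.pi D) :=
    integrable_finsetSum _ fun j _ => (hd j).1.add (hd' j).1
  refine (integral_mono (integrable_winShare mU' mL' _) ((integrable_winShare mU mL _).add hs)
    (winShare_le_add_sum hU hL)).trans_eq ?_
  simp only [Pi.add_apply]
  rw [integral_add (integrable_winShare mU mL _) hs]
  congr 1
  refine (integral_finsetSum _ fun j _ => (hd j).1.add (hd' j).1).trans ?_
  refine Finset.sum_congr rfl fun j _ => ?_
  exact (integral_add (hd j).1 (hd' j).1).trans (by rw [(hd j).2, (hd' j).2])

end WinShare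

/-! ### Bracketing the shares -/

/-- The functions `winShare U L` with lower sets `U j`, `L j` are bracketed by finitely many
measurable functions. -/
theorem exists_winShare_brackets {ι : Type*} [Fintype ι] [DecidableEq ι] {T : ι → Set ℝ}
    (D : ∀ j, Measure (T j)) [∀ j, IsProbabilityMeasure (D j)] {N : ℕ} (hN : 0 < N) :
    ∃ h : (ι → Fin (N + 1)) × (ι → Fin (N + 1)) × Bool → (∀ j, T j) → ℝ,
      (∀ a, Measurable (h a)) ∧ (∀ a w, h a w ∈ Set.Icc (0 : ℝ) 1) ∧
      ∀ U L : ∀ j, Set (T j), (∀ j, IsLowerSet (U j)) → (∀ j, IsLowerSet (L j)) →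
        ∃ a b, (∀ w, h a w ≤ winShare U L w) ∧ (∀ w, winShare U L w ≤ h b w) ∧
          ∫ w, h b w ∂Measure.pi D ≤ ∫ w, h a w ∂Measure.pi D + 2 * Fintype.card ι / N := by
  choose A B hA hB hAB using fun j => exists_lowerSet_brackets (D j) hN
  -- The two index families choose the brackets of `U` and `L` independently; the Boolean selects
  -- the upper or the lower function.
  refine ⟨fun a => bif a.2.2 then winShare (fun j => B j (a.1 j)) (fun j => B j (a.2.1 j))
    else winShare (fun j => A j (a.1 j)) (fun j => A j (a.2.1 j)), ?_, ?_, ?_⟩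
  · rintro ⟨k, l, _ | _⟩
    · exact measurable_winShare (fun j => hA j _) (fun j => hA j _)
    · exact measurable_winShare (fun j => hB j _) (fun j => hB j _)
  · rintro ⟨k, l, _ | _⟩ w <;> exact winShare_mem_Icc _ _ w
  · intro U L hU hL
    choose k hk1 hk2 hk3 using fun j => hAB j (U j) (hU j)
    choose l hl1 hl2 hl3 using fun j => hAB j (L j) (hL j)
    refine ⟨(k, l, false), (k, l, true), winShare_mono hk1 hl1, winShare_mono hk2 hl2, ?_⟩
    refine (integral_winShare_le_add_sum D (fun j => (hk1 j).trans (hk2 j))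
      (fun j => (hl1 j).trans (hl2 j)) (fun j => hA j _) (fun j => hA j _) (fun j => hB j _)
      (fun j => hB j _)).trans ?_
    have : ∑ j, ((D j).real (B j (k j) \ A j (k j)) + (D j).real (B j (l j) \ A j (l j)))
        ≤ ∑ _j : ι, (1 / N + 1 / N : ℝ) := Finset.sum_le_sum fun j _ => add_le_add (hk3 j) (hl3 j)
    simp only [Finset.sum_const, Finset.card_univ, nsmul_eq_mul] at this
    refine add_le_add le_rfl (this.trans_eq (by ring))

/-- Outside the failure events of finitely many brackets, the empirical means of all
`winShare U L` with lower sets are close to their expectations. -/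
theorem abs_empirical_mean_winShare_sub_integral_lt {ι κ : Type*} [Fintype ι] {T : ι → Set ℝ}
    (D : ∀ j, Measure (T j)) [∀ j, IsProbabilityMeasure (D j)] {h : κ → (∀ j, T j) → ℝ}
    (hm : ∀ a, Measurable (h a)) (h01 : ∀ a w, h a w ∈ Set.Icc (0 : ℝ) 1)
    {U L : ∀ j, Set (T j)} (hU : ∀ j, IsLowerSet (U j)) (hL : ∀ j, IsLowerSet (L j)) {a b : κ}
    (ha : ∀ w, h a w ≤ winShare U L w) (hb : ∀ w, winShare U L w ≤ h b w) {t t' : ℝ}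
    (hab : ∫ w, h b w ∂Measure.pi D ≤ ∫ w, h a w ∂Measure.pi D + t')
    {m : ℕ} {S : Fin m → ∀ j, T j}
    (hS : ∀ c, |(1 / (m : ℝ)) * ∑ k, h c (S k) - ∫ w, h c w ∂Measure.pi D| < t) :
    |(1 / (m : ℝ)) * ∑ k, winShare U L (S k) - ∫ w, winShare U L w ∂Measure.pi D| < t + t' := by
  have hint (c) : Integrable (h c) (Measure.pi D) :=
    Integrable.of_mem_Icc 0 1 (hm c).aemeasurable (.of_forall (h01 c))
  have hi : Integrable (winShare U L) (Measure.pi D) :=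
    integrable_winShare (fun j => measurableSet_of_isLowerSet_subtype (hU j))
      (fun j => measurableSet_of_isLowerSet_subtype (hL j)) _
  have h1 := integral_mono (hint a) hi ha
  have h2 := integral_mono hi (hint b) hb
  have h3 : (1 / (m : ℝ)) * ∑ k, h a (S k) ≤ (1 / (m : ℝ)) * ∑ k, winShare U L (S k) := by
    gcongr with k; exact ha _
  have h4 : (1 / (m : ℝ)) * ∑ k, winShare U L (S k) ≤ (1 / (m : ℝ)) * ∑ k, h b (S k) := by
    gcongr with k; exact hb _
  have h5 := abs_lt.1 (hS a)
  have h6 := abs_lt.1 (hS b)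
  rw [abs_lt]
  constructor <;> linarith

theorem measurePreserving_restrict_subtype {ι : Type*} [Fintype ι] {X : ι → Type*}
    [∀ j, MeasurableSpace (X j)] (D : ∀ j, Measure (X j)) [∀ j, IsProbabilityMeasure (D j)]
    (q : ι → Prop) [DecidablePred q] :
    MeasurePreserving (fun (w : ∀ j, X j) (j : Subtype q) => w j) (Measure.pi D)
      (Measure.pi fun j : Subtype q => D j) :=
  measurePreserving_fst.comp (measurePreserving_piEquivPiSubtypeProd D q)


/-! ### From auction utilities to shares -/

theorem mem_winners_joinBids {n : ℕ} {H : ℝ} {i : Fin n} {bi : Bid H}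
    {c : {j : Fin n // j ≠ i} → Bid H} : i ∈ winners (joinBids i bi c) ↔ ∀ j, c j ≤ bi := by
  simp only [winners, Finset.mem_filter, Finset.mem_univ, true_and]
  simp only [joinBids, dite_true]
  constructor
  · intro h j
    simpa [j.2] using h j
  · intro h j
    by_cases hj : j = i
    · simp [hj]
    · simpa [hj] using h ⟨j, hj⟩

theorem card_winners_joinBids {n : ℕ} {H : ℝ} {i : Fin n} {bi : Bid H}
    {c : {j : Fin n // j ≠ i} → Bid H} (h : ∀ j, c j ≤ bi) :
    (winners (joinBids i bi c)).card = 1 + (Finset.univ.filter fun j => ¬ c j < bi).card := by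
  have hi : i ∉ (Finset.univ.filter fun j => ¬ c j < bi).map (Function.Embedding.subtype _) := by
    simp
  have hmax (j) : joinBids i bi c j ≤ bi := by
    by_cases hj : j = i
    · simp [joinBids, hj]
    · simpa [joinBids, hj] using h ⟨j, hj⟩
  have key : winners (joinBids i bi c) =
      Finset.cons i ((Finset.univ.filter fun j => ¬ c j < bi).map
        (Function.Embedding.subtype _)) hi := by
    ext k
    simp only [winners, Finset.mem_filter, Finset.mem_univ, true_and, Finset.mem_cons,
      Finset.mem_map, Function.Embedding.subtype_apply, not_lt]
    constructor
    · intro hk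
      by_cases hki : k = i
      · exact .inl hki
      · refine .inr ⟨⟨k, hki⟩, ?_, rfl⟩
        simpa [joinBids, hki] using hk i
    · rintro (rfl | ⟨k, hk, rfl⟩) j
      · simpa [joinBids] using hmax j
      · refine (hmax j).trans ?_
        simpa [joinBids, k.2] using hk
  rw [key, Finset.card_cons, Finset.card_map, add_comm]

variable {n : ℕ} {H : ℝ} {T : Fin n → Set ℝ}

theorem alloc_joinBids_eq_winShare (i : Fin n) (bi : Bid H)
    (s : (j : {j : Fin n // j ≠ i}) → T j → Bid H) (w : (j : {j : Fin n // j ≠ i}) → T j) :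
    alloc (joinBids i bi fun j => s j (w j)) i =
      winShare (fun j => {x | s j x ≤ bi}) (fun j => {x | s j x < bi}) w := by
  simp only [alloc, winShare, mem_winners_joinBids, Set.mem_ofPred_eq]
  split_ifs with h
  · rw [card_winners_joinBids h]
    push_cast
    congr
  · rfl

theorem exPostUtility_joinBids (p : PaymentRule n H) (i : Fin n) (v : ℝ) (bi : Bid H)
    (s : (j : {j : Fin n // j ≠ i}) → T j → Bid H) (w : (j : {j : Fin n // j ≠ i}) → T j) :
    exPostUtility p i v (joinBids i bi fun j => s j (w j)) =
      (v - p.f i bi) * winShare (fun j => {x | s j x ≤ bi}) (fun j => {x | s j x < bi}) w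
        - p.g i bi := by
  have : joinBids i bi (fun j => s j (w j)) i = bi := by simp [joinBids]
  rw [exPostUtility, pay, alloc_joinBids_eq_winShare, this]
  ring

/-- The term `g` does not depend on the rivals, so it cancels; `0 < m` is needed for the empirical
average of a constant to be that constant. -/
theorem emp_sub_interimUtility (p : PaymentRule n H) (D : (i : Fin n) → Measure (T i))
    [∀ i, IsProbabilityMeasure (D i)] {s : Profile H T} (hs : s ∈ monotoneProfiles H T)
    {m : ℕ} (hm : 0 < m) (S : Fin m → (i : Fin n) → T i) (i : Fin n) (v : T i) :
    emp p S i v s - interimUtility p D i v (s i v) (fun j => s j) =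
      (v - p.f i (s i v)) * ((1 / (m : ℝ)) * ∑ k, winShare
          (fun j : {j : Fin n // j ≠ i} => {x | s j x ≤ s i v}) (fun j => {x | s j x < s i v})
          (fun j => S k j)
        - ∫ w, winShare (fun j : {j : Fin n // j ≠ i} => {x | s j x ≤ s i v})
          (fun j => {x | s j x < s i v}) w ∂Measure.pi fun j : {j : Fin n // j ≠ i} => D j) := by
  have hm' : (0 : ℝ) < m := by exact_mod_cast hm
  have hi := integrable_winShare
    (U := fun j : {j : Fin n // j ≠ i} => {x | s j x ≤ s i v})
    (L := fun j : {j : Fin n // j ≠ i} => {x | s j x < s i v})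
    (fun j => measurableSet_of_isLowerSet_subtype fun _ _ hxy hx => (hs j hxy).trans hx)
    (fun j => measurableSet_of_isLowerSet_subtype fun _ _ hxy hx => (hs j hxy).trans_lt hx)
    (Measure.pi fun j : {j : Fin n // j ≠ i} => D j)
  simp only [emp, interimUtility, exPostUtility_joinBids p i v (s i v) (fun j => s j)]
  rw [integral_sub (hi.const_mul _) (integrable_const _), integral_const_mul, integral_const,
    Finset.sum_sub_distrib, ← Finset.mul_sum]
  simp only [Finset.sum_const, Finset.card_univ, Fintype.card_fin, nsmul_eq_mul, probReal_univ,
    one_smul]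
  field_simp
  ring

/-- The errors of the empirical win probabilities control those of the empirical utilities. -/
theorem estimatesUtilities_of_winShare (p : PaymentRule n H) (hH : 0 < H)
    (hT : ∀ i, T i ⊆ Set.Icc 0 H) {m : ℕ} (hm : 0 < m) {ε δ : ℝ}
    (h : ∀ (D : (i : Fin n) → Measure (T i)) [∀ i, IsProbabilityMeasure (D i)],
      (Measure.pi fun _ : Fin m => Measure.pi D)
        {S | ¬ ∀ (i : Fin n) (U L : (j : {j : Fin n // j ≠ i}) → Set (T j)),
          (∀ j, IsLowerSet (U j)) → (∀ j, IsLowerSet (L j)) →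
          |(1 / (m : ℝ)) * ∑ k, winShare U L (fun j => S k j) -
            ∫ w, winShare U L w ∂Measure.pi fun j : {j : Fin n // j ≠ i} => D j| < ε / H}
      ≤ ENNReal.ofReal δ) :
    EstimatesUtilities p (emp p : Estimator m H T) (monotoneProfiles H T) ε δ := by
  intro D _
  refine (measure_mono ?_).trans (h D)
  intro S hS hS'
  refine hS fun s hs i v => ?_
  rw [emp_sub_interimUtility p D hs hm, abs_mul]
  have h1 := hS' i (fun j => {x | s j x ≤ s i v}) (fun j => {x | s j x < s i v})
    (fun j _ _ hxy hx => (hs j hxy).trans hx) (fun j _ _ hxy hx => (hs j hxy).trans_lt hx)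
  have h2 : |(v : ℝ) - p.f i (s i v)| ≤ H := by
    have := hT i v.2
    have := p.f_mem i (s i v)
    simp only [Set.mem_Icc] at *
    rw [abs_le]
    constructor <;> linarith
  calc _ ≤ H * _ := mul_le_mul_of_nonneg_right h2 (abs_nonneg _)
    _ < H * (ε / H) := mul_lt_mul_of_pos_left h1 hH
    _ = ε := by field_simp

/-! ### Union bound and sample size -/

theorem measure_winShare_error_le (D : (i : Fin n) → Measure (T i))
    [∀ i, IsProbabilityMeasure (D i)] {m N : ℕ} (hm : 0 < m) (hN : 0 < N) {t η : ℝ} (ht : 0 ≤ t)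
    (htη : t + 2 * n / N ≤ η) :
    (Measure.pi fun _ : Fin m => Measure.pi D)
        {S | ¬ ∀ (i : Fin n) (U L : (j : {j : Fin n // j ≠ i}) → Set (T j)),
          (∀ j, IsLowerSet (U j)) → (∀ j, IsLowerSet (L j)) →
          |(1 / (m : ℝ)) * ∑ k, winShare U L (fun j => S k j) -
            ∫ w, winShare U L w ∂Measure.pi fun j : {j : Fin n // j ≠ i} => D j| < η}
      ≤ ENNReal.ofReal (4 * n * ((N : ℝ) + 1) ^ (2 * n) * Real.exp (-(2 * m * t ^ 2))) := by
  have hcard (i : Fin n) : Fintype.card {j : Fin n // j ≠ i} ≤ n :=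
    (Fintype.card_subtype_le _).trans_eq (Fintype.card_fin n)
  choose h hmeas h01 hbr using fun i : Fin n =>
    exists_winShare_brackets (fun j : {j : Fin n // j ≠ i} => D j) hN
  have hres (i : Fin n) := measurePreserving_restrict_subtype D (fun j => j ≠ i)
  have hint (i : Fin n) (c) :
      ∫ w, h i c (fun j : {j : Fin n // j ≠ i} => w j) ∂Measure.pi D =
        ∫ w, h i c w ∂Measure.pi fun j : {j : Fin n // j ≠ i} => D j := by
    rw [← (hres i).map_eq]
    exact (integral_map (hres i).measurable.aemeasurable
      (hmeas i c).aestronglyMeasurable).symm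
  have hbad (i : Fin n) := measure_exists_abs_empirical_mean_sub_integral_ge_le (Measure.pi D)
    (h := fun c w => h i c (fun j : {j : Fin n // j ≠ i} => w j))
    (fun c => (hmeas i c).comp (hres i).measurable) (fun c w => h01 i c _) hm ht
  simp only [hint] at hbad
  calc _ ≤ (Measure.pi fun _ : Fin m => Measure.pi D) (⋃ i : Fin n,
        {S | ∃ c, t ≤ |(1 / (m : ℝ)) * ∑ k, h i c (fun j => S k j) -
          ∫ w, h i c w ∂Measure.pi fun j : {j : Fin n // j ≠ i} => D j|}) := by
        refine measure_mono fun S hS => ?_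
        by_contra hS'
        simp only [Set.mem_iUnion, Set.mem_ofPred_eq, not_exists, not_le] at hS'
        refine hS ?_
        intro i U L hU hL
        obtain ⟨a, b, ha, hb, hab⟩ := hbr i U L hU hL
        refine (abs_empirical_mean_winShare_sub_integral_lt _ (hmeas i) (h01 i) hU hL ha hb hab
          (hS' i)).trans_le (htη.trans' ?_)
        gcongr
        exact_mod_cast hcard i
    _ ≤ ∑ i : Fin n, _ := measure_iUnion_fintype_le _ _
    -- The first factor 2 counts upper and lower brackets, the second the two Hoeffding tails; the
    -- number of rivals is bounded by `n`.
    _ ≤ ∑ _i : Fin n, ENNReal.ofReal (2 * ((N : ℝ) + 1) ^ (2 * n) *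
          (2 * Real.exp (-(2 * m * t ^ 2)))) := by
        refine Finset.sum_le_sum fun i _ => (hbad i).trans ?_
        rw [ENNReal.ofReal_mul (p := 2 * ((N : ℝ) + 1) ^ (2 * n)) (by positivity)]
        gcongr
        rw [← ENNReal.ofReal_natCast]
        refine ENNReal.ofReal_le_ofReal ?_
        simp only [Fintype.card_prod, Fintype.card_pi, Fintype.card_fin, Finset.prod_const,
          Finset.card_univ, Fintype.card_bool]
        push_cast
        rw [← mul_assoc, ← pow_add, mul_comm]
        gcongr
        · linarith [Nat.cast_nonneg (α := ℝ) N]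
        · have := hcard i
          omega
    _ = _ := by
        rw [Finset.sum_const, Finset.card_univ, Fintype.card_fin, nsmul_eq_mul,
          ← ENNReal.ofReal_natCast, ← ENNReal.ofReal_mul (by positivity)]
        congr 1
        ring

theorem exists_bracket_count {n m : ℕ} (hn : 2 ≤ n) {η δ : ℝ} (hη : 0 < η) (hη1 : η ≤ 1)
    (hδ : 0 < δ) (hδ1 : δ < 1)
    (hm : 24 * (1 / η ^ 2 * (n * Real.log n * max 1 (Real.log (1 / η)) + Real.log (n / δ))) ≤ m) :
    ∃ N : ℕ, 0 < N ∧ η / 2 + 2 * n / N ≤ η ∧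
      4 * n * ((N : ℝ) + 1) ^ (2 * n) * Real.exp (-(2 * m * (η / 2) ^ 2)) ≤ δ := by
  have hn' : (2 : ℝ) ≤ n := by exact_mod_cast hn
  have hx : 0 < 4 * n / η := by positivity
  -- This `N` makes the bracket gap at most `η / 2`, leaving `η / 2` for Hoeffding.
  refine ⟨⌈4 * n / η⌉₊, Nat.ceil_pos.2 hx, ?_, ?_⟩
  · have h1 : 4 * n / η ≤ ⌈4 * n / η⌉₊ := Nat.le_ceil _
    have h2 : 2 * n / (⌈4 * n / η⌉₊ : ℝ) ≤ 2 * n / (4 * n / η) := by gcongr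
    have h3 : 2 * n / (4 * n / η) = η / 2 := by field_simp; norm_num
    linarith
  set N := ⌈4 * n / η⌉₊
  have hN : (N : ℝ) + 1 ≤ 6 * n / η := by
    have h1 : (N : ℝ) < 4 * n / η + 1 := Nat.ceil_lt_add_one hx.le
    have h2 : 2 ≤ 2 * n / η := by
      rw [le_div_iff₀ hη]; nlinarith
    have h3 : 6 * n / η = 4 * n / η + 2 * n / η := by ring
    linarith
  set l := Real.log n
  set M := max 1 (Real.log (1 / η))
  have hl2 : 0.69 ≤ Real.log 2 := by linarith [Real.log_two_gt_d9]
  have hl : Real.log 2 ≤ l := Real.log_le_log (by norm_num) hn'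
  have hM1 : 1 ≤ M := le_max_left _ _
  have hM2 : Real.log (1 / η) ≤ M := le_max_right _ _
  -- `n ≥ 2` enters here: `l ≥ log 2` absorbs `log 6` into `3 * l` and `M` into `1.5 * (l * M)`, for
  -- a total of `5.5 * (l * M)`.
  have hlogN : Real.log (N + 1) ≤ 6 * (l * M) := by
    have h1 : Real.log (N + 1) ≤ Real.log (6 * n / η) :=
      Real.log_le_log (by positivity) hN
    have h2 : Real.log (6 * n / η) = Real.log 6 + l + Real.log (1 / η) := by
      rw [mul_div_assoc, div_eq_mul_one_div, ← mul_assoc, Real.log_mul (by positivity)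
        (by positivity), Real.log_mul (by positivity) (by positivity)]
    have h3 : Real.log 6 ≤ 3 * Real.log 2 := by
      rw [← Real.log_rpow (by norm_num)]
      exact Real.log_le_log (by norm_num) (by norm_num)
    have h4 : l ≤ l * M := by nlinarith
    have h5 : M ≤ 1.5 * (l * M) := by nlinarith
    nlinarith
  have hlogδ : Real.log 2 ≤ Real.log (n / δ) := by
    refine Real.log_le_log (by norm_num) ?_
    rw [le_div_iff₀ hδ]; nlinarith
  have hlog4 : Real.log 4 = 2 * Real.log 2 := by
    rw [← Real.log_rpow (by norm_num)]
    norm_num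
  have hmη : 24 * (n * l * M + Real.log (n / δ)) ≤ m * η ^ 2 := by
    have := mul_le_mul_of_nonneg_right hm (sq_nonneg η)
    calc _ = 24 * (1 / η ^ 2 * (n * l * M + Real.log (n / δ))) * η ^ 2 := by field_simp
      _ ≤ _ := this
  -- The right side is `m * η ^ 2 / 2`, so the constant 24 supplies the `12 * (n * l * M)` needed
  -- for `2 * n * log (N + 1)`.
  have key : Real.log 4 + Real.log (n / δ) + 2 * n * Real.log (N + 1) ≤ 2 * m * (η / 2) ^ 2 := by
    have : 2 * n * Real.log (N + 1) ≤ 2 * n * (6 * (l * M)) := by gcongr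
    nlinarith
  calc 4 * n * ((N : ℝ) + 1) ^ (2 * n) * Real.exp (-(2 * m * (η / 2) ^ 2))
      ≤ 4 * n * ((N : ℝ) + 1) ^ (2 * n) *
          Real.exp (-(Real.log 4 + Real.log (n / δ) + 2 * n * Real.log (N + 1))) := by gcongr
    _ = δ := by
        have h1 : Real.exp (2 * n * Real.log (N + 1)) = ((N : ℝ) + 1) ^ (2 * n) := by
          have : (2 * n * Real.log (N + 1) : ℝ) = ((2 * n : ℕ) : ℝ) * Real.log (N + 1) := by
            push_cast; ring
          rw [this, Real.exp_nat_mul, Real.exp_log (by positivity)]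
        rw [Real.exp_neg, Real.exp_add, Real.exp_add, Real.exp_log (by norm_num),
          Real.exp_log (by positivity), h1]
        field_simp

theorem estimatesUtilities_zero (p : PaymentRule n 0) (hT : ∀ i, T i ⊆ Set.Icc 0 0) {m : ℕ}
    {ε δ : ℝ} (hε : 0 < ε) :
    EstimatesUtilities p (emp p : Estimator m 0 T) (monotoneProfiles 0 T) ε δ := by
  intro D _
  have hf (i b) : p.f i b = 0 := by simpa using p.f_mem i b
  have hg (i b) : p.g i b = 0 := by simpa using p.g_mem i b
  have hv (i) (v : T i) : (v : ℝ) = 0 := by simpa using hT i v.2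
  have hU (i) (v : T i) (b) : exPostUtility p i v b = 0 := by
    simp [exPostUtility, pay, hf, hg, hv]
  simp [emp, interimUtility, hU, hε]

end SampleAuction

theorem theorem1 :
    ∃ C : ℝ, 0 < C ∧
      ∀ (n : ℕ) (H ε δ : ℝ), 0 ≤ H → 0 < ε → 0 < δ → δ < 1 →
      ∀ m : ℕ,
        C * (H ^ 2 / ε ^ 2 *
          ((n : ℝ) * Real.log (n : ℝ) * max 1 (Real.log (H / ε))
            + Real.log ((n : ℝ) / δ))) ≤ (m : ℝ) →
      ∀ T : Fin n → Set ℝ, (∀ i, T i ⊆ Set.Icc 0 H) →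
      ∀ p : SampleAuction.PaymentRule n H,
        SampleAuction.EstimatesUtilities p
          (SampleAuction.emp p : SampleAuction.Estimator m H T)
          (SampleAuction.monotoneProfiles H T) ε δ := by
  refine ⟨24, by norm_num, fun n H ε δ hH hε hδ hδ1 m hm T hT p => ?_⟩
  rcases hH.eq_or_lt with rfl | hH
  · exact SampleAuction.estimatesUtilities_zero p hT hε
  rcases Nat.eq_zero_or_pos n with rfl | hn
  · intro D _
    simp
  have hn1 : (1 : ℝ) ≤ n := by exact_mod_cast hn
  have hm0 : 0 < m := by
    have h1 : 0 < Real.log (n / δ) := Real.log_pos (by rw [lt_div_iff₀ hδ]; linarith)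
    have h2 : 0 ≤ Real.log n := Real.log_nonneg hn1
    have : (0 : ℝ) < m := hm.trans_lt' (by positivity)
    exact_mod_cast this
  have hm' : (0 : ℝ) < m := by exact_mod_cast hm0
  refine SampleAuction.estimatesUtilities_of_winShare p hH hT hm0 fun D _ => ?_
  have hη : 0 < ε / H := by positivity
  -- Here `log n = 0`, so the bound pays for no brackets; but without rivals the share is constantly
  -- one and the error vanishes.
  rcases eq_or_ne n 1 with rfl | hn2
  · refine (measure_mono_null (t := ∅) (fun S hS => ?_) measure_empty).trans_le zero_le
    refine hS fun i U L _ _ => ?_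
    have : IsEmpty {j : Fin 1 // j ≠ i} := ⟨fun j => j.2 (Subsingleton.elim _ _)⟩
    simp [SampleAuction.winShare, hm'.ne', hη]
  rcases le_or_gt (ε / H) 1 with hη1 | hη1
  · have he : 1 / (ε / H) ^ 2 = H ^ 2 / ε ^ 2 := by field_simp
    have he' : 1 / (ε / H) = H / ε := by field_simp
    obtain ⟨N, hN, h1, h2⟩ := SampleAuction.exists_bracket_count (n := n) (m := m) (by omega)
      hη hη1 hδ hδ1 (by rwa [he, he'])
    exact (SampleAuction.measure_winShare_error_le D hm0 hN (by positivity) h1).trans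
      (ENNReal.ofReal_le_ofReal h2)
  -- Both the empirical and the true mean share lie in `[0, 1]`, so an error of `ε / H > 1` is
  -- impossible.
  · refine (measure_mono_null (t := ∅) (fun S hS => ?_) measure_empty).trans_le zero_le
    refine hS fun i U L hU hL => ?_
    refine hη1.trans_le' ?_
    have h01 := SampleAuction.winShare_mem_Icc U L
    have h1 : 0 ≤ (1 / (m : ℝ)) * ∑ k, SampleAuction.winShare U L (fun j => S k j) :=
      mul_nonneg (by positivity) (Finset.sum_nonneg fun k _ => (h01 _).1)
    have h2 : (1 / (m : ℝ)) * ∑ k, SampleAuction.winShare U L (fun j => S k j) ≤ 1 := by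
      rw [one_div_mul_eq_div, div_le_one hm']
      exact (Finset.sum_le_sum fun k _ => (h01 _).2).trans_eq (by simp)
    have h3 := integral_nonneg (μ := Measure.pi fun j : {j : Fin n // j ≠ i} => D j)
      (f := SampleAuction.winShare U L) fun w => (h01 w).1
    have h4 := integral_mono (μ := Measure.pi fun j : {j : Fin n // j ≠ i} => D j)
      (f := SampleAuction.winShare U L) (SampleAuction.integrable_winShare
        (fun j => SampleAuction.measurableSet_of_isLowerSet_subtype (hU j))
        (fun j => SampleAuction.measurableSet_of_isLowerSet_subtype (hL j)) _)
      (integrable_const 1) fun w => (h01 w).2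
    simp only [integral_const, probReal_univ, one_smul] at h4
    rw [abs_le]
    constructor <;> linarith
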